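/- Let $H = L^2((0,1);\mathbb{R})$ (Lebesgue measure), let $e_n = \sqrt{2}\sin(n\pi\,\cdot\,) \in H$, $n \in \mathbb{N} = \{1,2,\dots\}$ (an orthonormal basis of $H$), let $c_0 \in (0,\infty)$, $c_1 \in \mathbb{R}$, and let $A$ be the diagonal operator on $H$ with $A e_n = -c_0\pi^2 n^2 e_n$ (that is, $c_0$ times the Laplacian with zero Dirichlet boundary conditions). Let $H_r$, $r \in \mathbb{R}$, be the interpolation spaces associated to $-A$: for $r \ge 0$, $$H_r = D((-A)^r) = \Big\{ v \in H : \sum_{n} \big| (c_0\pi^2n^2)^r \langle e_n, v\rangle_H \big|^2 < \infty \Big\}, \qquad \|v\|_{H_r} = \|(-A)^r v\|_H = \Big(\sum_{n} \big| (c_0\pi^2n^2)^r \langle e_n, v\rangle_H \big|^2\Big)^{1/2},$$ and for $r \ge 0$ the space $H_{-r}$ is the completion of $H$ with respect to the norm $v \mapsto \|(-A)^{-r}v\|_H$. Let $F \colon H_{1/2} \to H$ be given by $F(w) = c_1\, w\, \partial w$, where $\partial w \in H$ is the weak derivative of $w$ on $(0,1)$. Let $\gamma \in (\tfrac18, \tfrac12]$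 and $\nu \in [\tfrac12-\gamma, \tfrac12]$ satisfy $\nu > \tfrac34 - 2\gamma$. Then: (0) $F$ is well defined: every $w \in H_{1/2}$ has a weak derivative $\partial w \in H$, and $w\,\partial w \in H$. (i) There exists a unique continuous function $\bar F \colon H_\gamma \to H_{-\nu}$ which satisfies $\bar F(v) = F(v)$ for every $v \in H_{1/2}$. (ii) There exists $C \in \mathbb{R}$ such that for all $v, w \in H_\gamma$ $$\|\bar F(v) - \bar F(w)\|_{H_{-\nu}} \le C\, \|v-w\|_{H_\gamma}\, \big(1 + \|v\|_{H_\gamma} + \|w\|_{H_\gamma}\big).$$ -/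

import Mathlib

open MeasureTheory Set
open scoped Real ContDiff InnerProductSpace NNReal

noncomputable section

namespace Burgers

/-- Lebesgue measure on the open unit interval. -/
abbrev lam : Measure ℝ := volume.restrict (Ioo (0 : ℝ) 1)

/-- The real Hilbert space `H = L²((0,1); ℝ)`. -/
abbrev H : Type := Lp ℝ 2 lam

/-! ### The sine basis of `H` -/

/-- The function `x ↦ √2 sin(n π x)`, with `n` replaced by `n + 1` so that `n` runs through
all natural numbers including `0`. -/
def sineFun (n : ℕ) (x : ℝ) : ℝ := √2 * Real.sin ((n + 1 : ℝ) * π * x)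

theorem memLp_sineFun (n : ℕ) : MemLp (sineFun n) 2 lam := by
  refine MemLp.of_bound (C := √2) ?_ ?_
  · unfold sineFun
    exact (by fun_prop : Continuous fun x : ℝ => √2 * Real.sin ((n + 1 : ℝ) * π * x)).aestronglyMeasurable
  · refine Filter.Eventually.of_forall fun x => ?_
    rw [sineFun, norm_mul, Real.norm_of_nonneg (Real.sqrt_nonneg 2)]
    exact mul_le_of_le_one_right (Real.sqrt_nonneg 2) (Real.abs_sin_le_one _)

/-- The element of `H` given by `x ↦ √2 sin((n + 1) π x)`. -/
def sineVec (n : ℕ) : H := (memLp_sineFun n).toLp (sineFun n)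

theorem integral_cos_int_mul_pi (k : ℤ) (hk : k ≠ 0) :
    ∫ x in (0 : ℝ)..1, Real.cos (k * π * x) = 0 := by
  have h : (k : ℝ) * π ≠ 0 := mul_ne_zero (by exact_mod_cast hk) Real.pi_ne_zero
  rw [intervalIntegral.integral_comp_mul_left (fun x => Real.cos x) h, integral_cos]
  simp [Real.sin_int_mul_pi]

theorem orthonormal_sineVec : Orthonormal ℝ sineVec := by
  classical
  rw [orthonormal_iff_ite]
  intro i j
  have h1 : ⟪sineVec i, sineVec j⟫_ℝ = ∫ x in (0 : ℝ)..1, sineFun i x * sineFun j x := by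
    rw [L2.inner_def, intervalIntegral.integral_of_le zero_le_one, integral_Ioc_eq_integral_Ioo]
    refine integral_congr_ae ?_
    filter_upwards [(memLp_sineFun i).coeFn_toLp, (memLp_sineFun j).coeFn_toLp] with x hi hj
    rw [sineVec, sineVec, hi, hj]
    simp [mul_comm]
  have h2 : ∀ x : ℝ, sineFun i x * sineFun j x =
      Real.cos (((i : ℤ) - j : ℤ) * π * x) - Real.cos (((i : ℤ) + j + 2 : ℤ) * π * x) := by
    intro x
    have e1 : (((i : ℤ) - j : ℤ) : ℝ) * π * x = (i + 1 : ℝ) * π * x - (j + 1 : ℝ) * π * x := by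
      push_cast; ring
    have e2 : (((i : ℤ) + j + 2 : ℤ) : ℝ) * π * x = (i + 1 : ℝ) * π * x + (j + 1 : ℝ) * π * x := by
      push_cast; ring
    rw [e1, e2, Real.cos_sub, Real.cos_add, sineFun, sineFun]
    linear_combination Real.sin ((i + 1 : ℝ) * π * x) * Real.sin ((j + 1 : ℝ) * π * x) *
      Real.mul_self_sqrt (zero_le_two (α := ℝ))
  rw [h1]
  simp_rw [h2]
  rw [intervalIntegral.integral_sub
    ((by fun_prop : Continuous _).intervalIntegrable _ _)
    ((by fun_prop : Continuous _).intervalIntegrable _ _),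
    integral_cos_int_mul_pi ((i : ℤ) + j + 2) (by omega)]
  by_cases hij : i = j
  · subst hij; simp
  · rw [integral_cos_int_mul_pi _ (by omega), if_neg hij, sub_zero]

theorem eq_zero_of_inner_sineVec (v : H) (hv : ∀ n, ⟪sineVec n, v⟫_ℝ = 0) : v = 0 := by
  -- Odd reflection of `v` to `(-1, 1)`, all of whose Fourier coefficients vanish.
  set u : ℝ → ℂ := (Ioo (0 : ℝ) 1).indicator fun x => ((v x : ℝ) : ℂ) with hu
  have hmem : MemLp u 2 volume :=
    (memLp_indicator_iff_restrict measurableSet_Ioo).2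
      (MemLp.ofReal (K := ℂ) (Lp.memLp v : MemLp (v : ℝ → ℝ) 2 lam))
  have hsub : Ioo (0 : ℝ) 1 ⊆ Ioc (-1 : ℝ) 1 := fun x hx => ⟨by linarith [hx.1], hx.2.le⟩
  have hneg : MemLp (fun x => u (-x)) 2 volume :=
    hmem.comp_measurePreserving (Measure.measurePreserving_neg volume)
  have hf : MemLp (fun x => u x - u (-x)) 2 (volume.restrict (Ioc (-1 : ℝ) 1)) :=
    (hmem.sub hneg).restrict _
  have hsin : ∀ k : ℤ, ∫ x in (-1 : ℝ)..1, u x * (Real.sin (k * π * x) : ℂ) = 0 := by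
    have hnat : ∀ n : ℕ, ∫ x in (-1 : ℝ)..1, u x * (Real.sin ((n + 1 : ℝ) * π * x) : ℂ) = 0 := by
      intro n
      have h1 : ∫ x in Ioo (0 : ℝ) 1, v x * sineFun n x = 0 := by
        refine Eq.trans ?_ (hv n)
        rw [L2.inner_def]
        refine integral_congr_ae ?_
        filter_upwards [(memLp_sineFun n).coeFn_toLp] with x hx
        rw [sineVec, hx]
        simp
      have h2 : ∫ x in Ioo (0 : ℝ) 1, v x * Real.sin ((n + 1 : ℝ) * π * x) = 0 := by
        have : ∀ x, v x * sineFun n x = √2 * (v x * Real.sin ((n + 1 : ℝ) * π * x)) := by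
          intro x; rw [sineFun]; ring
        simp_rw [this] at h1
        rw [integral_const_mul] at h1
        exact (mul_eq_zero.1 h1).resolve_left (by positivity)
      rw [intervalIntegral.integral_of_le (by norm_num)]
      have h3 : (fun x => u x * (Real.sin ((n + 1 : ℝ) * π * x) : ℂ)) =
          (Ioo (0 : ℝ) 1).indicator
            fun x => ((v x * Real.sin ((n + 1 : ℝ) * π * x) : ℝ) : ℂ) := by
        ext x
        by_cases hx : x ∈ Ioo (0 : ℝ) 1 <;> simp [hu, hx]
      rw [h3, setIntegral_indicator measurableSet_Ioo,
        inter_eq_self_of_subset_right hsub,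
        integral_complex_ofReal, h2]
      simp
    intro k
    rcases lt_trichotomy k 0 with hk | rfl | hk
    · obtain ⟨n, hn⟩ := Int.eq_ofNat_of_zero_le (show 0 ≤ -k - 1 by omega)
      have hk' : (k : ℝ) = -(n + 1 : ℝ) := by
        have : k = -((n : ℤ) + 1) := by omega
        rw [this]; push_cast; ring
      have := hnat n
      simp_rw [hk', neg_mul, Real.sin_neg, Complex.ofReal_neg, mul_neg]
      rw [intervalIntegral.integral_neg, this, neg_zero]
    · simp
    · obtain ⟨n, hn⟩ := Int.eq_ofNat_of_zero_le (show 0 ≤ k - 1 by omega)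
      have hk' : (k : ℝ) = (n + 1 : ℝ) := by
        have : k = (n : ℤ) + 1 := by omega
        rw [this]; push_cast; ring
      rw [hk']
      exact hnat n
  have hint : ∀ {w : ℝ → ℂ}, MemLp w 2 volume → IntervalIntegrable w volume (-1) 1 := by
    intro w hw
    rw [intervalIntegrable_iff_integrableOn_Ioc_of_le (by norm_num)]
    exact (hw.restrict _).integrable (by norm_num)
  have hcoef : ∀ k : ℤ,
      fourierCoeffOn (show (-1 : ℝ) < 1 by norm_num) (fun x => u x - u (-x)) k = 0 := by
    intro k
    rw [fourierCoeffOn_eq_integral]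
    have hexp : ∀ x : ℝ, (fourier (-k) (x : AddCircle ((1 : ℝ) - -1)) : ℂ) =
        (Real.cos (k * π * x) : ℂ) - (Real.sin (k * π * x) : ℂ) * Complex.I := by
      intro x
      rw [fourier_coe_apply]
      have : (2 * π * Complex.I * ((-k : ℤ) : ℂ) * (x : ℂ) / (((1 : ℝ) - -1 : ℝ) : ℂ)) =
          ((-(k * π * x) : ℝ) : ℂ) * Complex.I := by
        push_cast; ring
      rw [this, Complex.exp_mul_I, ← Complex.ofReal_cos, ← Complex.ofReal_sin, Real.cos_neg,
        Real.sin_neg]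
      push_cast; ring
    have hc : Continuous fun x : ℝ => (fourier (-k) (x : AddCircle ((1 : ℝ) - -1)) : ℂ) := by
      simp_rw [hexp]; fun_prop
    simp_rw [smul_eq_mul, mul_sub]
    have i1 := (hint hmem).continuousOn_mul hc.continuousOn
    have i2 := (hint hneg).continuousOn_mul hc.continuousOn
    rw [intervalIntegral.integral_sub i1 i2]
    have hrefl : ∫ x in (-1 : ℝ)..1, (fourier (-k) (x : AddCircle ((1 : ℝ) - -1)) : ℂ) * u (-x) =
        ∫ x in (-1 : ℝ)..1, (fourier (-k) ((-x : ℝ) : AddCircle ((1 : ℝ) - -1)) : ℂ) * u x := by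
      have := intervalIntegral.integral_comp_neg (a := -1) (b := 1)
        (fun x : ℝ => (fourier (-k) ((-x : ℝ) : AddCircle ((1 : ℝ) - -1)) : ℂ) * u x)
      simpa only [neg_neg] using this
    have i3 := (hint hmem).continuousOn_mul (hc.comp continuous_neg).continuousOn
    simp only [Function.comp_def] at i3
    rw [hrefl, ← intervalIntegral.integral_sub i1 i3]
    have hfin : ∀ x : ℝ, (fourier (-k) (x : AddCircle ((1 : ℝ) - -1)) : ℂ) * u x -
        (fourier (-k) ((-x : ℝ) : AddCircle ((1 : ℝ) - -1)) : ℂ) * u x =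
        (-2 * Complex.I) * (u x * (Real.sin (k * π * x) : ℂ)) := by
      intro x
      rw [hexp, hexp, mul_neg, Real.cos_neg, Real.sin_neg]
      push_cast; ring
    simp only [hfin]
    rw [intervalIntegral.integral_const_mul, hsin k, mul_zero, smul_zero]
  have hzero : ∫ x in (-1 : ℝ)..1, ‖u x - u (-x)‖ ^ 2 = 0 := by
    have h := hasSum_sq_fourierCoeffOn (show (-1 : ℝ) < 1 by norm_num) hf
    simp_rw [hcoef] at h
    have h0 : HasSum (fun _ : ℤ => ‖(0 : ℂ)‖ ^ 2) 0 := by simp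
    have h' := h.unique h0
    rw [smul_eq_mul] at h'
    exact (mul_eq_zero.1 h').resolve_left (by norm_num)
  rw [intervalIntegral.integral_of_le (by norm_num),
    integral_eq_zero_iff_of_nonneg (fun x => by positivity) hf.integrable_norm_pow'] at hzero
  rw [Lp.eq_zero_iff_ae_eq_zero]
  have hres : (fun x => ‖u x - u (-x)‖ ^ 2) =ᵐ[lam] 0 :=
    ae_mono (Measure.restrict_mono hsub le_rfl) hzero
  filter_upwards [hres, ae_restrict_mem measurableSet_Ioo] with x hx hx01
  have hx' : -x ∉ Ioo (0 : ℝ) 1 := fun h => by linarith [h.1, hx01.1]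
  simpa [hu, hx01, hx'] using hx

/-- The functions `x ↦ √2 sin(n π x)`, `n ≥ 1`, as a Hilbert basis of `H`. -/
def sineBasis : HilbertBasis ℕ ℝ H :=
  HilbertBasis.mkOfOrthogonalEqBot orthonormal_sineVec <| by
    rw [Submodule.eq_bot_iff]
    intro v hv
    exact eq_zero_of_inner_sineVec v fun n =>
      (Submodule.mem_orthogonal _ v).1 hv _ (Submodule.subset_span ⟨n, rfl⟩)

@[simp]
theorem sineBasis_apply (n : ℕ) : sineBasis n = sineVec n :=
  congrFun (HilbertBasis.coe_mkOfOrthogonalEqBot _ _) n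

/-! ### Fractional powers of `-A` and the spaces `H_r`

`A` is `c₀` times the Dirichlet Laplacian, i.e. the diagonal operator on `H` with
`A e_n = -c₀ π² n² e_n`, where `e_n = √2 sin(n π ·)`. -/

/-- The eigenvalue `c₀ π² (n + 1)²` of `-A` that belongs to `sineBasis n`. -/
def eigenvalue (c₀ : {c : ℝ // 0 < c}) (n : ℕ) : ℝ := c₀ * π ^ 2 * (n + 1 : ℝ) ^ 2

theorem eigenvalue_pos (c₀ : {c : ℝ // 0 < c}) (n : ℕ) : 0 < eigenvalue c₀ n := by
  have := c₀.2
  unfold eigenvalue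
  positivity

theorem eigenvalue_zero_le (c₀ : {c : ℝ // 0 < c}) (n : ℕ) :
    eigenvalue c₀ 0 ≤ eigenvalue c₀ n := by
  have := c₀.2
  unfold eigenvalue
  gcongr
  simp

/-- The coefficients `(c₀ π² n²)^r ⟨e_n, v⟩` of `(-A)^r v`. -/
def fracCoeff (c₀ : {c : ℝ // 0 < c}) (r : ℝ) (v : H) (n : ℕ) : ℝ :=
  eigenvalue c₀ n ^ r * ⟪sineBasis n, v⟫_ℝ

/-- The domain `D((-A)^r) = {v ∈ H : ∑ₙ |(c₀ π² n²)^r ⟨e_n, v⟩|² < ∞}`, as a subspace of `H`. -/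
def fracDomain (c₀ : {c : ℝ // 0 < c}) (r : ℝ) : Submodule ℝ H where
  carrier := {v | Memℓp (fracCoeff c₀ r v) 2}
  add_mem' {v w} hv hw := by
    have : fracCoeff c₀ r (v + w) = fracCoeff c₀ r v + fracCoeff c₀ r w := by
      ext n; simp [fracCoeff, inner_add_right, mul_add]
    simpa only [mem_ofPred_eq, this] using Memℓp.add hv hw
  zero_mem' := by
    have : fracCoeff c₀ r 0 = 0 := by ext n; simp [fracCoeff]
    simpa only [mem_ofPred_eq, this] using zero_memℓp
  smul_mem' a v hv := by
    have : fracCoeff c₀ r (a • v) = a • fracCoeff c₀ r v := by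
      ext n; simp [fracCoeff, inner_smul_right, mul_left_comm]
    simpa only [mem_ofPred_eq, this] using Memℓp.const_smul hv a

theorem mem_fracDomain_iff (c₀ : {c : ℝ // 0 < c}) (r : ℝ) (v : H) :
    v ∈ fracDomain c₀ r ↔
      Summable fun n => (eigenvalue c₀ n ^ r * ⟪sineBasis n, v⟫_ℝ) ^ 2 := by
  change Memℓp (fracCoeff c₀ r v) 2 ↔ _
  rw [memℓp_gen_iff (by norm_num)]
  simp [fracCoeff, ← abs_mul]

theorem fracDomain_anti (c₀ : {c : ℝ // 0 < c}) {r s : ℝ} (h : r ≤ s) :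
    fracDomain c₀ s ≤ fracDomain c₀ r := by
  intro v hv
  rw [mem_fracDomain_iff] at hv ⊢
  refine (hv.mul_left ((eigenvalue c₀ 0 ^ (r - s)) ^ 2)).of_nonneg_of_le
    (fun n => sq_nonneg _) fun n => ?_
  rw [← mul_pow, ← mul_assoc, mul_pow, mul_pow _ ⟪_, _⟫_ℝ]
  have hn := eigenvalue_pos c₀ n
  have h0 := eigenvalue_pos c₀ 0
  have key : eigenvalue c₀ n ^ r ≤ eigenvalue c₀ 0 ^ (r - s) * eigenvalue c₀ n ^ s := by
    calc eigenvalue c₀ n ^ r = eigenvalue c₀ n ^ (r - s) * eigenvalue c₀ n ^ s := by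
          rw [← Real.rpow_add hn]; congr 1; ring
      _ ≤ _ := by
          refine mul_le_mul_of_nonneg_right ?_ (Real.rpow_nonneg hn.le s)
          exact Real.rpow_le_rpow_of_nonpos h0 (eigenvalue_zero_le c₀ n) (sub_nonpos.2 h)
  gcongr

/-- For `r ≤ 0` the operator `(-A)^r` is defined on all of `H`. -/
theorem mem_fracDomain_of_nonpos (c₀ : {c : ℝ // 0 < c}) {r : ℝ} (hr : r ≤ 0) (v : H) :
    v ∈ fracDomain c₀ r := by
  refine fracDomain_anti c₀ hr ((mem_fracDomain_iff c₀ 0 v).2 ?_)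
  simpa using sineBasis.orthonormal.inner_products_summable (x := v)

/-- The operator `(-A)^r : D((-A)^r) → H`, `v ↦ ∑ₙ (c₀ π² n²)^r ⟨e_n, v⟩ e_n`. -/
def fracPow (c₀ : {c : ℝ // 0 < c}) (r : ℝ) : fracDomain c₀ r →ₗ[ℝ] H where
  toFun v := sineBasis.repr.symm ⟨fracCoeff c₀ r v, v.2⟩
  map_add' v w := by
    rw [← map_add]; congr 1; ext n
    change fracCoeff c₀ r ((v : H) + w) n = fracCoeff c₀ r v n + fracCoeff c₀ r w n
    simp [fracCoeff, inner_add_right, mul_add]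
  map_smul' a v := by
    rw [RingHom.id_apply, ← map_smul]; congr 1; ext n
    change fracCoeff c₀ r (a • (v : H)) n = a * fracCoeff c₀ r v n
    simp [fracCoeff, inner_smul_right, mul_left_comm]

theorem inner_fracPow (c₀ : {c : ℝ // 0 < c}) (r : ℝ) (v : fracDomain c₀ r) (n : ℕ) :
    ⟪sineBasis n, fracPow c₀ r v⟫_ℝ = eigenvalue c₀ n ^ r * ⟪sineBasis n, (v : H)⟫_ℝ := by
  rw [← HilbertBasis.repr_apply_apply]
  simp [fracPow, fracCoeff]

theorem fracPow_injective (c₀ : {c : ℝ // 0 < c}) (r : ℝ) :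
    Function.Injective (fracPow c₀ r) := by
  intro v w h
  have hn : ∀ n, ⟪sineBasis n, (v : H)⟫_ℝ = ⟪sineBasis n, (w : H)⟫_ℝ := fun n => by
    have := congrArg (fun z => ⟪sineBasis n, z⟫_ℝ) h
    simp only [inner_fracPow] at this
    exact mul_left_cancel₀ (Real.rpow_pos_of_pos (eigenvalue_pos c₀ n) r).ne' this
  apply Subtype.ext
  apply sineBasis.repr.injective
  ext n
  simp only [HilbertBasis.repr_apply_apply, hn]

/-- The vector space `D((-A)^r)` with the norm `‖v‖ = ‖(-A)^r v‖_H`. It is a type of its own, so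
that it does not carry the norm of `H`. For `r ≥ 0` this is the interpolation space `H_r`. -/
def HPos (c₀ : {c : ℝ // 0 < c}) (r : ℝ) : Type := fracDomain c₀ r

instance (c₀ : {c : ℝ // 0 < c}) (r : ℝ) : AddCommGroup (HPos c₀ r) :=
  inferInstanceAs (AddCommGroup (fracDomain c₀ r))

instance (c₀ : {c : ℝ // 0 < c}) (r : ℝ) : Module ℝ (HPos c₀ r) :=
  inferInstanceAs (Module ℝ (fracDomain c₀ r))

/-- `(-A)^r` as a linear map on `HPos c₀ r`. -/
def HPos.pow (c₀ : {c : ℝ // 0 < c}) (r : ℝ) : HPos c₀ r →ₗ[ℝ] H := fracPow c₀ r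

instance (c₀ : {c : ℝ // 0 < c}) (r : ℝ) : NormedAddCommGroup (HPos c₀ r) :=
  NormedAddCommGroup.induced (HPos c₀ r) H (HPos.pow c₀ r) (fracPow_injective c₀ r)

instance (c₀ : {c : ℝ // 0 < c}) (r : ℝ) : NormedSpace ℝ (HPos c₀ r) :=
  NormedSpace.induced ℝ (HPos c₀ r) H (HPos.pow c₀ r)

theorem HPos.norm_def (c₀ : {c : ℝ // 0 < c}) (r : ℝ) (v : HPos c₀ r) :
    ‖v‖ = ‖HPos.pow c₀ r v‖ := rfl

/-- The element of `H` underlying an element of `D((-A)^r)`. -/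
def HPos.val {c₀ : {c : ℝ // 0 < c}} {r : ℝ} (v : HPos c₀ r) : H := Subtype.val v

/-- The inclusion `H_s ⊆ H_r` for `r ≤ s`. -/
def HPos.incl (c₀ : {c : ℝ // 0 < c}) {r s : ℝ} (h : r ≤ s) : HPos c₀ s →ₗ[ℝ] HPos c₀ r :=
  Submodule.inclusion (fracDomain_anti c₀ h)

/-- For `ν ≥ 0` the interpolation space `H_{-ν}`: the completion of `H` with respect to the norm
`v ↦ ‖(-A)^{-ν} v‖_H` (recall that `D((-A)^{-ν}) = H`). -/
abbrev HNeg (c₀ : {c : ℝ // 0 < c}) (ν : ℝ≥0) : Type :=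
  UniformSpace.Completion (HPos c₀ (-(ν : ℝ)))

/-- The canonical embedding `H ⊆ H_{-ν}`. -/
def toHNeg (c₀ : {c : ℝ // 0 < c}) (ν : ℝ≥0) (v : H) : HNeg c₀ ν :=
  UniformSpace.Completion.coe'
    (show HPos c₀ (-(ν : ℝ)) from
      ⟨v, mem_fracDomain_of_nonpos c₀ (neg_nonpos.2 ν.2) v⟩)

/-! ### The nonlinearity -/

/-- `g ∈ L²((0,1))` is the weak derivative of `v ∈ L²((0,1))`. -/
def IsWeakDeriv (v g : H) : Prop :=
  ∀ φ : ℝ → ℝ, ContDiff ℝ ∞ φ → HasCompactSupport φ → tsupport φ ⊆ Ioo (0 : ℝ) 1 →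
    ∫ x in Ioo (0 : ℝ) 1, g x * φ x = -∫ x in Ioo (0 : ℝ) 1, v x * deriv φ x

open Classical in
/-- The weak derivative `∂v` of `v ∈ W^{1,2}((0,1))`; the value is `0` for all other `v ∈ H`. -/
def weakDeriv (v : H) : H := if h : ∃ g, IsWeakDeriv v g then h.choose else 0

open Classical in
/-- The nonlinearity `F : H_{1/2} → H`, `F(w) = c₁ w ∂w`. (The value would be `0` if the product
failed to lie in `L²`.) -/
def burgersF (c₀ : {c : ℝ // 0 < c}) (c₁ : ℝ) (w : HPos c₀ (1 / 2)) : H :=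
  if h : MemLp (fun x => c₁ * (w.val x * weakDeriv w.val x)) 2 lam then h.toLp else 0

/-- `G : H_γ → H_{-ν}` is a continuous extension of `F : H_{1/2} → H`. -/
def IsContExtension (c₀ : {c : ℝ // 0 < c}) (c₁ : ℝ) {γ : ℝ} (hγ : γ ≤ 1 / 2) (ν : ℝ≥0)
    (G : HPos c₀ γ → HNeg c₀ ν) : Prop :=
  Continuous G ∧
    ∀ v : HPos c₀ (1 / 2), G (HPos.incl c₀ hγ v) = toHNeg c₀ ν (burgersF c₀ c₁ v)

end Burgers

end

open Burgers

open Filter Topology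

noncomputable section

namespace Burgers

/-! ### Continuous functions as elements and multipliers of `H` -/

/-! Since `w ∂w = ½ ∂(w²)`, testing `F(w)` against a sine moves the derivative onto the sine: the
`n`-th coefficient of `F(w)` is a multiple of `n ∫ w² cos(nπ·)` (`coeff_burgersF`). This involves no
derivative of `w` and is quadratic, so `v² - w² = (v - w)(v + w)` reduces the Lipschitz estimate to
the bilinear bound `‖∂(uv)‖_{H_{-ν}} ≤ C ‖u‖_{H_γ} ‖v‖_{H_γ}`.

For that bound (`exists_sum_sq_weighted_inner_le`), expand `u` and `v` in sines. The integral of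
`e_k e_l cos(nπ·)` vanishes unless `n = k + l` or `n = |k - l|`, so `n` is at most twice the larger
of `k` and `l`. Write `λ_j` for the eigenvalues of `-A`. The factor `n` and the `H_{-ν}` weight
combine to a multiple of `λ_n^(1/2 - ν)`, which the larger of `λ_k`, `λ_l` absorbs because `1/2 - ν
≤ γ`; the weight `λ^(1/2 - ν - 2γ)` remains on the smaller one (`weight_le`). What is left is a
discrete convolution of an `ℓ¹` and an `ℓ²` sequence (`sum_sq_sum_kernel_le`). By Cauchy-Schwarz the
first is in `ℓ¹` as soon as `∑ λ_k^(2(1/2 - ν - 2γ))` is finite, which is exactly `ν > 3/4 - 2γ`.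

The estimate holds on `H_{1/2}` in terms of `H_γ` norms. As `H_{1/2}` is dense in `H_γ` and `H_{-ν}`
is complete, `F` extends continuously and uniquely, and the estimate passes to the limit. -/

theorem exists_ae_bound (f : C(ℝ, ℝ)) : ∃ C, ∀ᵐ x ∂lam, ‖f x‖ ≤ C := by
  obtain ⟨C, hC⟩ := (isCompact_Icc (a := (0 : ℝ)) (b := 1)).exists_bound_of_continuousOn
    f.continuous.continuousOn
  exact ⟨C, (ae_restrict_mem measurableSet_Ioo).mono fun x hx => hC x (Ioo_subset_Icc_self hx)⟩

theorem memLp_continuousMap (f : C(ℝ, ℝ)) : MemLp f 2 lam := by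
  obtain ⟨C, hC⟩ := exists_ae_bound f
  exact MemLp.of_bound f.continuous.aestronglyMeasurable C hC

/-- The class in `H` of a continuous function. -/
def toH : C(ℝ, ℝ) →ₗ[ℝ] H where
  toFun f := (memLp_continuousMap f).toLp f
  map_add' _ _ := rfl
  map_smul' _ _ := rfl

theorem coeFn_toH (f : C(ℝ, ℝ)) : toH f =ᵐ[lam] f := (memLp_continuousMap f).coeFn_toLp

theorem inner_eq_integral (u v : H) : ⟪u, v⟫_ℝ = ∫ x in Ioo (0 : ℝ) 1, u x * v x := by
  rw [L2.inner_def]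
  exact integral_congr_ae (Eventually.of_forall fun x => by simp [mul_comm])

theorem inner_toH_right (u : H) (f : C(ℝ, ℝ)) :
    ⟪u, toH f⟫_ℝ = ∫ x in Ioo (0 : ℝ) 1, u x * f x := by
  rw [inner_eq_integral]
  refine integral_congr_ae ?_
  filter_upwards [coeFn_toH f] with x hx
  rw [hx]

theorem inner_toH_toH (f g : C(ℝ, ℝ)) :
    ⟪toH f, toH g⟫_ℝ = ∫ x in (0 : ℝ)..1, f x * g x := by
  rw [inner_toH_right, intervalIntegral.integral_of_le zero_le_one, integral_Ioc_eq_integral_Ioo]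
  refine integral_congr_ae ?_
  filter_upwards [coeFn_toH f] with x hx
  rw [hx]

theorem memLp_mul (f : C(ℝ, ℝ)) (u : H) : MemLp (fun x => f x * u x) 2 lam := by
  obtain ⟨C, hC⟩ := exists_ae_bound f
  refine MemLp.of_le_mul (c := C) (Lp.memLp u)
    (f.continuous.aestronglyMeasurable.mul (Lp.aestronglyMeasurable u)) ?_
  filter_upwards [hC] with x hx
  rw [norm_mul]
  gcongr

/-- Multiplication by a continuous function, as a bounded operator on `H`. -/
def mulH (f : C(ℝ, ℝ)) : H →L[ℝ] H :=
  LinearMap.mkContinuousOfExistsBound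
    { toFun := fun u => (memLp_mul f u).toLp _
      map_add' := fun u v => by
        ext1
        filter_upwards [(memLp_mul f (u + v)).coeFn_toLp, (memLp_mul f u).coeFn_toLp,
          (memLp_mul f v).coeFn_toLp, Lp.coeFn_add u v,
          Lp.coeFn_add ((memLp_mul f u).toLp _) ((memLp_mul f v).toLp _)] with x h1 h2 h3 h4 h5
        rw [h5, h1, h4, Pi.add_apply, Pi.add_apply, h2, h3, mul_add]
      map_smul' := fun a u => by
        ext1
        filter_upwards [(memLp_mul f (a • u)).coeFn_toLp, (memLp_mul f u).coeFn_toLp,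
          Lp.coeFn_smul a u, Lp.coeFn_smul a ((memLp_mul f u).toLp _)] with x h1 h2 h3 h4
        rw [RingHom.id_apply, h4, h1, h3, Pi.smul_apply, Pi.smul_apply, h2, smul_eq_mul,
          smul_eq_mul, mul_left_comm] } <| by
    obtain ⟨C, hC⟩ := exists_ae_bound f
    refine ⟨C, fun u => Lp.norm_le_mul_norm_of_ae_le_mul ?_⟩
    filter_upwards [(memLp_mul f u).coeFn_toLp, hC] with x hx hx'
    change ‖(memLp_mul f u).toLp _ x‖ ≤ _
    rw [hx, norm_mul]
    gcongr

theorem coeFn_mulH (f : C(ℝ, ℝ)) (u : H) : mulH f u =ᵐ[lam] fun x => f x * u x :=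
  (memLp_mul f u).coeFn_toLp

theorem mulH_toH (f g : C(ℝ, ℝ)) : mulH f (toH g) = toH (f * g) := by
  ext1
  filter_upwards [coeFn_mulH f (toH g), coeFn_toH g, coeFn_toH (f * g)] with x h1 h2 h3
  rw [h1, h2, h3, ContinuousMap.mul_apply]

theorem inner_mulH (f : C(ℝ, ℝ)) (u v : H) :
    ⟪u, mulH f v⟫_ℝ = ∫ x in Ioo (0 : ℝ) 1, f x * (u x * v x) := by
  rw [inner_eq_integral]
  refine integral_congr_ae ?_
  filter_upwards [coeFn_mulH f v] with x hx
  rw [hx]; ring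

theorem inner_mulH_comm (f : C(ℝ, ℝ)) (u v : H) : ⟪u, mulH f v⟫_ℝ = ⟪v, mulH f u⟫_ℝ := by
  simp_rw [inner_mulH, mul_comm (u _)]

/-- `u ↦ ⟪u, f u⟫` is a quadratic form, so differences of its values factor. -/
theorem inner_mulH_sub (f : C(ℝ, ℝ)) (u v : H) :
    ⟪u, mulH f u⟫_ℝ - ⟪v, mulH f v⟫_ℝ = ⟪u - v, mulH f (u + v)⟫_ℝ := by
  rw [map_add, inner_sub_left, inner_add_right, inner_add_right, inner_mulH_comm f v u]
  ring

/-! ### Trigonometric functions -/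

/-- `x ↦ √2 sin((n + 1) π x)` as a continuous map. -/
def sineMap (n : ℕ) : C(ℝ, ℝ) := ⟨sineFun n, by unfold sineFun; fun_prop⟩

/-- `x ↦ √2 cos((n + 1) π x)` as a continuous map. -/
def cosineMap (n : ℕ) : C(ℝ, ℝ) := ⟨fun x => √2 * Real.cos ((n + 1 : ℝ) * π * x), by fun_prop⟩

theorem toH_sineMap (n : ℕ) : toH (sineMap n) = sineBasis n := by
  rw [sineBasis_apply]; rfl

theorem hasDerivAt_sineMap (n : ℕ) (x : ℝ) :
    HasDerivAt (sineMap n) (((n + 1) * π) * cosineMap n x) x := by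
  have h : HasDerivAt (fun x : ℝ => (n + 1 : ℝ) * π * x) ((n + 1) * π) x := by
    simpa using (hasDerivAt_id x).const_mul ((n + 1 : ℝ) * π)
  have := h.sin.const_mul √2
  convert! this using 1
  simp only [cosineMap, ContinuousMap.coe_mk]; ring

theorem sineMap_zero (n : ℕ) : sineMap n 0 = 0 := by simp [sineMap, sineFun]

theorem sineMap_one (n : ℕ) : sineMap n 1 = 0 := by
  have := Real.sin_nat_mul_pi (n + 1)
  push_cast at this
  simp [sineMap, sineFun, this]

theorem norm_sineMap_le (n : ℕ) (x : ℝ) : ‖sineMap n x‖ ≤ √2 := by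
  change ‖√2 * _‖ ≤ _
  rw [norm_mul, Real.norm_of_nonneg (Real.sqrt_nonneg 2)]
  exact mul_le_of_le_one_right (Real.sqrt_nonneg 2) (Real.abs_sin_le_one _)

theorem integral_cos_int_mul_pi_eq_ite (k : ℤ) :
    ∫ x in (0 : ℝ)..1, Real.cos (k * π * x) = if k = 0 then 1 else 0 := by
  split_ifs with h
  · simp [h]
  · exact integral_cos_int_mul_pi k h

theorem orthonormal_cosine : Orthonormal ℝ fun n => toH (cosineMap n) := by
  classical
  rw [orthonormal_iff_ite]
  intro i j
  have h : ∀ x : ℝ, cosineMap i x * cosineMap j x =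
      Real.cos (((i : ℤ) - j : ℤ) * π * x) + Real.cos (((i : ℤ) + j + 2 : ℤ) * π * x) := by
    intro x
    have e1 : (((i : ℤ) - j : ℤ) : ℝ) * π * x = (i + 1 : ℝ) * π * x - (j + 1 : ℝ) * π * x := by
      push_cast; ring
    have e2 : (((i : ℤ) + j + 2 : ℤ) : ℝ) * π * x = (i + 1 : ℝ) * π * x + (j + 1 : ℝ) * π * x := by
      push_cast; ring
    rw [e1, e2, Real.cos_sub, Real.cos_add]
    simp only [cosineMap, ContinuousMap.coe_mk]
    linear_combination Real.cos ((i + 1 : ℝ) * π * x) * Real.cos ((j + 1 : ℝ) * π * x) *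
      Real.mul_self_sqrt (zero_le_two (α := ℝ))
  rw [inner_toH_toH]
  simp_rw [h]
  rw [intervalIntegral.integral_add
    ((by fun_prop : Continuous _).intervalIntegrable _ _)
    ((by fun_prop : Continuous _).intervalIntegrable _ _),
    integral_cos_int_mul_pi_eq_ite, integral_cos_int_mul_pi_eq_ite,
    if_neg (show ¬ (i : ℤ) + j + 2 = 0 by omega), add_zero]
  simp only [sub_eq_zero, Nat.cast_inj]

/-- The integrals of `e_k e_l cos((n + 1) π ·)`. -/
theorem integral_sine_mul_sine_mul_cosine (n k l : ℕ) :
    ∫ x in (0 : ℝ)..1, sineMap k x * (cosineMap n x * sineMap l x) =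
      √2 / 2 * ((if k = l + n + 1 then 1 else 0) + (if l = k + n + 1 then 1 else 0)
        - (if n = k + l + 1 then 1 else 0)) := by
  have h : ∀ x : ℝ, sineMap k x * (cosineMap n x * sineMap l x) =
      √2 / 2 * (((Real.cos (((k : ℤ) - l - n - 1 : ℤ) * π * x) +
        Real.cos (((l : ℤ) - k - n - 1 : ℤ) * π * x)) -
        Real.cos (((n : ℤ) - k - l - 1 : ℤ) * π * x)) -
        Real.cos (((n : ℤ) + k + l + 3 : ℤ) * π * x)) := by
    intro x
    set a := (k + 1 : ℝ) * π * x with ha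
    set b := (l + 1 : ℝ) * π * x with hb
    set c := (n + 1 : ℝ) * π * x with hc
    have e1 : (((k : ℤ) - l - n - 1 : ℤ) : ℝ) * π * x = a - b - c := by
      rw [ha, hb, hc]; push_cast; ring
    have e2 : (((l : ℤ) - k - n - 1 : ℤ) : ℝ) * π * x = b - a - c := by
      rw [ha, hb, hc]; push_cast; ring
    have e3 : (((n : ℤ) - k - l - 1 : ℤ) : ℝ) * π * x = c - (a + b) := by
      rw [ha, hb, hc]; push_cast; ring
    have e4 : (((n : ℤ) + k + l + 3 : ℤ) : ℝ) * π * x = c + (a + b) := by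
      rw [ha, hb, hc]; push_cast; ring
    have e5 : sineMap k x * (cosineMap n x * sineMap l x) =
        √2 * Real.sin a * (√2 * Real.cos c * (√2 * Real.sin b)) := rfl
    rw [e1, e2, e3, e4, e5]
    simp only [Real.cos_sub, Real.cos_add, Real.sin_sub, Real.sin_add]
    linear_combination √2 * Real.sin a * Real.sin b * Real.cos c *
      Real.mul_self_sqrt (zero_le_two (α := ℝ))
  simp_rw [h]
  have hi : ∀ m : ℤ, IntervalIntegrable (fun x : ℝ => Real.cos (m * π * x)) volume 0 1 :=
    fun m => (by fun_prop : Continuous _).intervalIntegrable _ _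
  rw [intervalIntegral.integral_const_mul,
    intervalIntegral.integral_sub (((hi _).add (hi _)).sub (hi _)) (hi _),
    intervalIntegral.integral_sub ((hi _).add (hi _)) (hi _),
    intervalIntegral.integral_add (hi _) (hi _)]
  simp only [integral_cos_int_mul_pi_eq_ite]
  rw [if_neg (show ¬ (n : ℤ) + k + l + 3 = 0 by omega), sub_zero]
  have e1 : (k : ℤ) - l - n - 1 = 0 ↔ k = l + n + 1 := by omega
  have e2 : (l : ℤ) - k - n - 1 = 0 ↔ l = k + n + 1 := by omega
  have e3 : (n : ℤ) - k - l - 1 = 0 ↔ n = k + l + 1 := by omega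
  simp only [e1, e2, e3]

/-! ### Partial sums of the sine series and weak derivatives -/

/-- The coefficient `⟨e_n, v⟩`. -/
abbrev coeff (v : H) (n : ℕ) : ℝ := ⟪sineBasis n, v⟫_ℝ

/-- The partial sums of the sine series of `v`, as continuous functions. -/
def partialSum (v : H) (N : ℕ) : C(ℝ, ℝ) := ∑ k ∈ Finset.range N, coeff v k • sineMap k

/-- The termwise derivatives of the partial sums of the sine series of `v`. -/
def partialDeriv (v : H) (N : ℕ) : C(ℝ, ℝ) :=
  ∑ k ∈ Finset.range N, (coeff v k * ((k + 1) * π)) • cosineMap k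

theorem toH_partialSum (v : H) (N : ℕ) :
    toH (partialSum v N) = ∑ k ∈ Finset.range N, coeff v k • sineBasis k := by
  simp only [partialSum, map_sum, map_smul, toH_sineMap]

theorem tendsto_partialSum (v : H) : Tendsto (fun N => toH (partialSum v N)) atTop (𝓝 v) := by
  simp_rw [toH_partialSum]
  simpa only [HilbertBasis.repr_apply_apply] using (sineBasis.hasSum_repr v).tendsto_sum_nat

theorem hasDerivAt_partialSum (v : H) (N : ℕ) (x : ℝ) :
    HasDerivAt (partialSum v N) (partialDeriv v N x) x := by
  have := HasDerivAt.fun_sum (u := Finset.range N) fun k _ =>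
    (hasDerivAt_sineMap k x).const_mul (coeff v k)
  convert! this using 1
  · ext y; simp [partialSum]
  · simp [partialDeriv, mul_assoc]

theorem partialSum_zero_right (v : H) (N : ℕ) : partialSum v N 0 = 0 := by
  simp [partialSum, sineMap_zero]

theorem partialSum_one (v : H) (N : ℕ) : partialSum v N 1 = 0 := by
  simp [partialSum, sineMap_one]

/-- Elements of `W₀^{1,2}`, described by their sine coefficients. -/
def IsH1 (v : H) : Prop := Summable fun n : ℕ => (coeff v n * ((n + 1) * π)) ^ 2

/-- The termwise derivatives are series in the orthonormal cosines, so square summability of the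
coefficients suffices for convergence in `H`. -/
theorem IsH1.exists_tendsto_partialDeriv {v : H} (hv : IsH1 v) :
    ∃ g : H, Tendsto (fun N => toH (partialDeriv v N)) atTop (𝓝 g) := by
  have h := (orthonormal_cosine.orthogonalFamily.summable_iff_norm_sq_summable
    (fun n : ℕ => coeff v n * ((n + 1) * π))).2 (by simpa only [Real.norm_eq_abs, sq_abs] using! hv)
  refine ⟨_, Tendsto.congr (fun N => ?_) h.hasSum.tendsto_sum_nat⟩
  simp [partialDeriv, map_sum, LinearIsometry.toSpanSingleton_apply]

/-- Integration by parts against a function whose boundary values vanish. -/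
theorem inner_deriv_eq_neg {f f' g g' : C(ℝ, ℝ)} (hf : ∀ x, HasDerivAt f (f' x) x)
    (hg : ∀ x, HasDerivAt g (g' x) x) (h0 : f 0 * g 0 = 0) (h1 : f 1 * g 1 = 0) :
    ⟪toH f', toH g⟫_ℝ = -⟪toH f, toH g'⟫_ℝ := by
  have h := intervalIntegral.integral_deriv_mul_eq_sub (a := 0) (b := 1) (fun x _ => hf x)
    (fun x _ => hg x) (f'.continuous.intervalIntegrable _ _) (g'.continuous.intervalIntegrable _ _)
  rw [intervalIntegral.integral_add
    ((by fun_prop : Continuous fun x => f' x * g x).intervalIntegrable _ _)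
    ((by fun_prop : Continuous fun x => f x * g' x).intervalIntegrable _ _), h0, h1, sub_zero] at h
  rw [inner_toH_toH, inner_toH_toH]
  linarith

theorem isWeakDeriv_of_tendsto {v g : H}
    (hg : Tendsto (fun N => toH (partialDeriv v N)) atTop (𝓝 g)) : IsWeakDeriv v g := by
  intro φ hφ _ hsupp
  have hd : Continuous (deriv φ) := hφ.continuous_deriv (by simp)
  let φc : C(ℝ, ℝ) := ⟨φ, hφ.continuous⟩
  let φd : C(ℝ, ℝ) := ⟨deriv φ, hd⟩
  have hφd : ∀ x, HasDerivAt φc (φd x) x := fun x =>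
    (hφ.differentiable (by simp) x).hasDerivAt
  have h : ∀ N, ⟪toH (partialDeriv v N), toH φc⟫_ℝ = -⟪toH (partialSum v N), toH φd⟫_ℝ :=
    fun N => inner_deriv_eq_neg (hasDerivAt_partialSum v N) hφd
      (by rw [partialSum_zero_right, zero_mul]) (by rw [partialSum_one, zero_mul])
  have l1 := hg.inner (𝕜 := ℝ) (tendsto_const_nhds (x := toH φc))
  have l2 := ((tendsto_partialSum v).inner (𝕜 := ℝ) (tendsto_const_nhds (x := toH φd))).neg
  simp_rw [h] at l1
  have := tendsto_nhds_unique l1 l2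
  rwa [inner_toH_right, inner_toH_right] at this

/-- `weakDeriv` is an arbitrary choice of a weak derivative; uniqueness identifies it with the limit
of the termwise derivatives. -/
theorem IsWeakDeriv.unique {v g₁ g₂ : H} (h₁ : IsWeakDeriv v g₁) (h₂ : IsWeakDeriv v g₂) :
    g₁ = g₂ := by
  have hint : ∀ u : H, IntegrableOn u (Ioo (0 : ℝ) 1) := fun u =>
    (Lp.memLp u).integrable (by norm_num)
  have h : ∀ᵐ x : ℝ ∂volume, x ∈ Ioo (0 : ℝ) 1 → g₁ x - g₂ x = 0 := by
    refine isOpen_Ioo.ae_eq_zero_of_integral_contDiff_smul_eq_zero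
      ((hint g₁).sub (hint g₂)).locallyIntegrableOn fun φ hφ hc hs => ?_
    let φc : C(ℝ, ℝ) := ⟨φ, hφ.continuous⟩
    have e : ∫ x, φ x • (g₁ x - g₂ x) = ∫ x in Ioo (0 : ℝ) 1, φ x • (g₁ x - g₂ x) := by
      refine (setIntegral_eq_integral_of_forall_compl_eq_zero fun x hx => ?_).symm
      rw [image_eq_zero_of_notMem_tsupport fun h => hx (hs h), zero_smul]
    have e' : ⟪g₁ - g₂, toH φc⟫_ℝ = 0 := by
      rw [inner_sub_left, inner_toH_right, inner_toH_right]
      exact sub_eq_zero.2 ((h₁ φ hφ hc hs).trans (h₂ φ hφ hc hs).symm)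
    refine e.trans (Eq.trans ?_ e')
    rw [inner_toH_right]
    refine integral_congr_ae ?_
    filter_upwards [Lp.coeFn_sub g₁ g₂] with x hx
    rw [hx, Pi.sub_apply, smul_eq_mul, mul_comm]
    rfl
  ext1
  filter_upwards [(ae_restrict_iff' measurableSet_Ioo).2 h] with x hx
  exact sub_eq_zero.1 hx

theorem IsH1.isWeakDeriv {v : H} (hv : IsH1 v) : IsWeakDeriv v (weakDeriv v) := by
  obtain ⟨g, hg⟩ := hv.exists_tendsto_partialDeriv
  have h : ∃ g, IsWeakDeriv v g := ⟨g, isWeakDeriv_of_tendsto hg⟩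
  rw [weakDeriv, dif_pos h]
  exact h.choose_spec

theorem IsH1.tendsto_weakDeriv {v : H} (hv : IsH1 v) :
    Tendsto (fun N => toH (partialDeriv v N)) atTop (𝓝 (weakDeriv v)) := by
  obtain ⟨g, hg⟩ := hv.exists_tendsto_partialDeriv
  rwa [hv.isWeakDeriv.unique (isWeakDeriv_of_tendsto hg)]

/-! ### Boundedness of `W₀^{1,2}` functions and square integrability of `v ∂v`. -/

theorem IsH1.summable_abs_coeff {v : H} (hv : IsH1 v) : Summable fun n => |coeff v n| := by
  have h2 : Summable fun n : ℕ => (((n + 1) * π : ℝ)⁻¹) ^ 2 := by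
    have := ((summable_nat_add_iff 1).2
      (Real.summable_nat_pow_inv.2 (one_lt_two))).mul_right ((π⁻¹) ^ 2)
    refine this.congr fun n => ?_
    push_cast
    rw [mul_inv, mul_pow, inv_pow, inv_pow]
  refine (hv.add h2).of_nonneg_of_le (fun n => abs_nonneg _) fun n => ?_
  have hp : (0 : ℝ) < (n + 1) * π := by positivity
  set p : ℝ := (n + 1) * π
  have e : |coeff v n| = |coeff v n * p| * p⁻¹ := by
    rw [abs_mul, abs_of_pos hp]; field_simp
  rw [e, ← sq_abs (coeff v n * p)]
  -- This is `a b ≤ a² + b²` with `a = |coeff v n| p` and `b = p⁻¹`.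
  nlinarith [sq_nonneg (|coeff v n * p| - p⁻¹), sq_nonneg (|coeff v n * p|), sq_nonneg p⁻¹]

/-- The partial sums are uniformly bounded by the absolutely summable coefficients, and a
subsequence of them converges almost everywhere to `v`. -/
theorem IsH1.exists_ae_bound {v : H} (hv : IsH1 v) : ∃ C, ∀ᵐ x ∂lam, ‖v x‖ ≤ C := by
  refine ⟨(∑' n, |coeff v n|) * √2, ?_⟩
  obtain ⟨ns, -, hns⟩ :=
    (tendstoInMeasure_of_tendsto_Lp (tendsto_partialSum v)).exists_seq_tendsto_ae
  have h2 : ∀ᵐ x ∂lam, ∀ N, toH (partialSum v N) x = partialSum v N x :=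
    ae_all_iff.2 fun N => coeFn_toH _
  filter_upwards [hns, h2] with x hx hx2
  refine le_of_tendsto hx.norm (Eventually.of_forall fun i => ?_)
  rw [hx2]
  calc ‖partialSum v (ns i) x‖ = ‖∑ k ∈ Finset.range (ns i), coeff v k * sineMap k x‖ := by
        simp [partialSum]
    _ ≤ ∑ k ∈ Finset.range (ns i), |coeff v k| * √2 := by
        refine norm_sum_le_of_le _ fun k _ => ?_
        rw [norm_mul, Real.norm_eq_abs (coeff v k)]
        exact mul_le_mul_of_nonneg_left (norm_sineMap_le k x) (abs_nonneg _)
    _ ≤ _ := by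
        rw [← Finset.sum_mul]
        exact mul_le_mul_of_nonneg_right
          (hv.summable_abs_coeff.sum_le_tsum _ fun _ _ => abs_nonneg _) (Real.sqrt_nonneg 2)

theorem IsH1.memLp_mul_weakDeriv {v : H} (hv : IsH1 v) (c : ℝ) :
    MemLp (fun x => c * (v x * weakDeriv v x)) 2 lam := by
  obtain ⟨C, hC⟩ := hv.exists_ae_bound
  refine (MemLp.of_le_mul (c := C) (Lp.memLp (weakDeriv v))
    ((Lp.aestronglyMeasurable v).mul (Lp.aestronglyMeasurable _)) ?_).const_mul c
  filter_upwards [hC] with x hx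
  rw [Pi.mul_apply, norm_mul]
  gcongr

/-- The weak form `∫ v v' e_n = -½ ∫ v² e_n'` of `v v' = ½ (v²)'`. -/
theorem IsH1.inner_mulH_weakDeriv {v : H} (hv : IsH1 v) (n : ℕ) :
    ⟪v, mulH (sineMap n) (weakDeriv v)⟫_ℝ =
      -((n + 1) * π / 2) * ⟪v, mulH (cosineMap n) v⟫_ℝ := by
  -- For a partial sum `V` and a sine `s`, integrating `V' (V s)` by parts gives `∫ V V' s = -∫ V
  -- (V' s + V s')`; solving for `∫ V V' s` produces the factor `½`. Both sides converge because
  -- multiplication by a fixed continuous function is bounded on `H`.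
  have h : ∀ N, ⟪toH (partialSum v N), mulH (sineMap n) (toH (partialDeriv v N))⟫_ℝ =
      -((n + 1) * π / 2) * ⟪toH (partialSum v N), mulH (cosineMap n) (toH (partialSum v N))⟫_ℝ := by
    intro N
    have hV := hasDerivAt_partialSum v N
    have h0 := partialSum_zero_right v N
    have h1 := partialSum_one v N
    set V := partialSum v N
    set V' := partialDeriv v N
    have := inner_deriv_eq_neg (f := V) (f' := V') (g := V * sineMap n)
      (g' := V' * sineMap n + V * (((n + 1) * π) • cosineMap n)) hV
      (fun x => (hV x).mul (hasDerivAt_sineMap n x))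
      (by rw [h0, zero_mul]) (by rw [h1, zero_mul])
    have e1 : ⟪toH V', toH (V * sineMap n)⟫_ℝ = ⟪toH V, mulH (sineMap n) (toH V')⟫_ℝ := by
      rw [inner_mulH_comm, mulH_toH, mul_comm]
    rw [e1, map_add, inner_add_right, mul_smul_comm, map_smul, inner_smul_right, mul_comm V',
      mul_comm V, ← mulH_toH, ← mulH_toH] at this
    linarith
  have l1 := (tendsto_partialSum v).inner (𝕜 := ℝ)
    (((mulH (sineMap n)).continuous.tendsto _).comp hv.tendsto_weakDeriv)
  have l2 := ((tendsto_partialSum v).inner (𝕜 := ℝ)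
    (((mulH (cosineMap n)).continuous.tendsto _).comp (tendsto_partialSum v))).const_mul
      (-((n + 1) * π / 2))
  simp only [Function.comp_def, h] at l1 l2
  exact tendsto_nhds_unique l1 l2

/-! ### Sine coefficients of the nonlinearity on `H_{1/2}`. -/

theorem HPos.isH1 {c₀ : {c : ℝ // 0 < c}} (w : HPos c₀ (1 / 2)) : IsH1 w.val := by
  have h := (mem_fracDomain_iff c₀ (1 / 2) w.val).1 w.2
  refine (h.mul_left (c₀ : ℝ)⁻¹).congr fun n => ?_
  have hc := c₀.2
  have e : (eigenvalue c₀ n ^ (1 / 2 : ℝ)) ^ 2 = eigenvalue c₀ n := by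
    rw [← Real.sqrt_eq_rpow, Real.sq_sqrt (eigenvalue_pos c₀ n).le]
  rw [mul_pow, e, eigenvalue]
  field_simp

/-- The product is square integrable for every `w`, so the default value `0` in `burgersF` is never
used. -/
theorem coeFn_burgersF (c₀ : {c : ℝ // 0 < c}) (c₁ : ℝ) (w : HPos c₀ (1 / 2)) :
    burgersF c₀ c₁ w =ᵐ[lam] fun x => c₁ * (w.val x * weakDeriv w.val x) := by
  have h := w.isH1.memLp_mul_weakDeriv c₁
  rw [burgersF, dif_pos h]
  exact h.coeFn_toLp

theorem coeff_burgersF (c₀ : {c : ℝ // 0 < c}) (c₁ : ℝ) (w : HPos c₀ (1 / 2)) (n : ℕ) :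
    coeff (burgersF c₀ c₁ w) n =
      -(c₁ * ((n + 1) * π / 2)) * ⟪w.val, mulH (cosineMap n) w.val⟫_ℝ := by
  have h : coeff (burgersF c₀ c₁ w) n = c₁ * ⟪w.val, mulH (sineMap n) (weakDeriv w.val)⟫_ℝ := by
    rw [coeff, real_inner_comm, ← toH_sineMap, inner_toH_right, inner_mulH, ← integral_const_mul]
    refine integral_congr_ae ?_
    filter_upwards [coeFn_burgersF c₀ c₁ w] with x hx
    rw [hx]; ring
  rw [h, w.isH1.inner_mulH_weakDeriv]
  ring

theorem coeff_burgersF_sub (c₀ : {c : ℝ // 0 < c}) (c₁ : ℝ) (v w : HPos c₀ (1 / 2)) (n : ℕ) :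
    coeff (burgersF c₀ c₁ v - burgersF c₀ c₁ w) n =
      -(c₁ * ((n + 1) * π / 2)) *
        ⟪v.val - w.val, mulH (cosineMap n) (v.val + w.val)⟫_ℝ := by
  rw [← inner_mulH_sub, mul_sub, ← coeff_burgersF, ← coeff_burgersF, coeff, inner_sub_right]

/-! ### A discrete convolution estimate -/

/-- A Young inequality `ℓ¹ * ℓ² → ℓ²`, proved as in Schur's test: after Cauchy-Schwarz, `h₃` bounds
the sum over `l` in one factor and `h₁` the sum over `n` in the other. -/
theorem sum_sq_sum_kernel_le {κ : ℕ → ℕ → ℕ → ℝ} {B : ℝ} (hκ : ∀ n k l, 0 ≤ κ n k l)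
    (h₁ : ∀ (s : Finset ℕ) k l, ∑ n ∈ s, κ n k l ≤ B)
    (h₃ : ∀ (s : Finset ℕ) n k, ∑ l ∈ s, κ n k l ≤ B) (s t : Finset ℕ) {x y : ℕ → ℝ}
    (hx : ∀ k, 0 ≤ x k) :
    ∑ n ∈ s, (∑ k ∈ t, ∑ l ∈ t, κ n k l * (x k * y l)) ^ 2 ≤
      B ^ 2 * ((∑ k ∈ t, x k) ^ 2 * ∑ l ∈ t, y l ^ 2) := by
  have hB : 0 ≤ B := by simpa using h₁ ∅ 0 0
  have hX : 0 ≤ ∑ k ∈ t, x k := Finset.sum_nonneg fun k _ => hx k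
  have cs : ∀ n, (∑ k ∈ t, ∑ l ∈ t, κ n k l * (x k * y l)) ^ 2 ≤
      (B * ∑ k ∈ t, x k) * ∑ k ∈ t, ∑ l ∈ t, κ n k l * (x k * y l ^ 2) := by
    intro n
    -- Cauchy-Schwarz with respect to the weights `κ x`, splitting `κ x y` as `√(κ x) · √(κ x y²)`.
    have h := Finset.sum_sq_le_sum_mul_sum_of_sq_le_mul (t ×ˢ t)
      (r := fun p => κ n p.1 p.2 * (x p.1 * y p.2)) (f := fun p => κ n p.1 p.2 * x p.1)
      (g := fun p => κ n p.1 p.2 * (x p.1 * y p.2 ^ 2))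
      (fun p _ => mul_nonneg (hκ _ _ _) (hx _))
      (fun p _ => mul_nonneg (hκ _ _ _) (mul_nonneg (hx _) (sq_nonneg _)))
      (fun p _ => le_of_eq (by ring))
    simp only [Finset.sum_product] at h
    refine h.trans (mul_le_mul_of_nonneg_right ?_ ?_)
    · rw [Finset.mul_sum]
      refine Finset.sum_le_sum fun k _ => ?_
      rw [← Finset.sum_mul]
      exact mul_le_mul_of_nonneg_right (h₃ t n k) (hx k)
    · exact Finset.sum_nonneg fun k _ => Finset.sum_nonneg fun l _ =>
        mul_nonneg (hκ _ _ _) (mul_nonneg (hx _) (sq_nonneg _))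
  calc _ ≤ ∑ n ∈ s, (B * ∑ k ∈ t, x k) * ∑ k ∈ t, ∑ l ∈ t, κ n k l * (x k * y l ^ 2) :=
        Finset.sum_le_sum fun n _ => cs n
    _ = (B * ∑ k ∈ t, x k) * ∑ k ∈ t, ∑ l ∈ t, (∑ n ∈ s, κ n k l) * (x k * y l ^ 2) := by
        rw [← Finset.mul_sum, Finset.sum_comm]
        congr 1
        refine Finset.sum_congr rfl fun k _ => ?_
        rw [Finset.sum_comm]
        simp_rw [Finset.sum_mul]
    _ ≤ (B * ∑ k ∈ t, x k) * ∑ k ∈ t, ∑ l ∈ t, B * (x k * y l ^ 2) := by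
        gcongr with k _ l _
        · exact mul_nonneg (hx k) (sq_nonneg _)
        · exact h₁ s k l
    _ = _ := by
        simp_rw [← Finset.mul_sum, ← Finset.sum_mul]
        ring

/-- The kernel of the resonances `k - l = ±n` and `k + l = n`, with all indices shifted by one. -/
def resonance (n k l : ℕ) : ℝ :=
  ((if k = l + n + 1 then 1 else 0) + (if l = k + n + 1 then 1 else 0)) +
    (if n = k + l + 1 then 1 else 0)

theorem resonance_nonneg (n k l : ℕ) : 0 ≤ resonance n k l := by
  unfold resonance
  positivity

theorem resonance_comm (n k l : ℕ) : resonance n k l = resonance n l k := by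
  simp only [resonance, add_comm k l, add_comm (if k = _ then (1 : ℝ) else 0)]

theorem sum_ite_le_one (s : Finset ℕ) (p : ℕ → Prop) [DecidablePred p]
    (hp : ∀ a b, p a → p b → a = b) : ∑ a ∈ s, (if p a then (1 : ℝ) else 0) ≤ 1 := by
  rw [Finset.sum_boole]
  have : (s.filter p).card ≤ 1 := Finset.card_le_one.2 fun a ha b hb =>
    hp a b (Finset.mem_filter.1 ha).2 (Finset.mem_filter.1 hb).2
  exact_mod_cast this

theorem sum_resonance_left_le (s : Finset ℕ) (k l : ℕ) : ∑ n ∈ s, resonance n k l ≤ 3 := by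
  simp only [resonance, Finset.sum_add_distrib]
  have h1 := sum_ite_le_one s (fun n => k = l + n + 1) fun a b _ _ => by omega
  have h2 := sum_ite_le_one s (fun n => l = k + n + 1) fun a b _ _ => by omega
  have h3 := sum_ite_le_one s (fun n => n = k + l + 1) fun a b _ _ => by omega
  linarith

theorem sum_resonance_right_le (s : Finset ℕ) (n k : ℕ) : ∑ l ∈ s, resonance n k l ≤ 3 := by
  simp only [resonance, Finset.sum_add_distrib]
  have h1 := sum_ite_le_one s (fun l => k = l + n + 1) fun a b _ _ => by omega
  have h2 := sum_ite_le_one s (fun l => l = k + n + 1) fun a b _ _ => by omega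
  have h3 := sum_ite_le_one s (fun l => n = k + l + 1) fun a b _ _ => by omega
  linarith

/-- Every resonance forces `n + 1 ≤ (k + 1) + (l + 1)`, which is at most twice the larger summand.
-/
theorem resonance_eq_zero_of_lt {n k l : ℕ} (hk : 2 * (k + 1) < n + 1) (hl : 2 * (l + 1) < n + 1) :
    resonance n k l = 0 := by
  rw [resonance, if_neg (by omega), if_neg (by omega), if_neg (by omega)]
  norm_num

theorem abs_inner_mulH_cosineMap_le (n k l : ℕ) :
    |⟪(sineBasis k : H), mulH (cosineMap n) (sineBasis l)⟫_ℝ| ≤ resonance n k l := by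
  rw [← toH_sineMap, ← toH_sineMap, mulH_toH, inner_toH_toH]
  simp only [ContinuousMap.mul_apply]
  rw [integral_sine_mul_sine_mul_cosine, abs_mul, abs_of_pos (by positivity), resonance]
  have h2 : √2 / 2 ≤ 1 := by
    have : √2 ≤ 2 := Real.sqrt_le_iff.2 (by norm_num)
    linarith
  refine (mul_le_of_le_one_left (abs_nonneg _) h2).trans ((abs_sub _ _).trans_eq ?_)
  rw [abs_of_nonneg (by positivity), abs_of_nonneg (by positivity)]

/-! ### Weights -/

theorem weight_le {a b m e γ : ℝ} (ha : 0 < a) (hb : 0 < b) (hm : 0 < m) (he : 0 ≤ e)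
    (heγ : e ≤ γ) (h : m ≤ 4 * a ∨ m ≤ 4 * b) :
    m ^ e * (a ^ (-γ) * b ^ (-γ)) ≤ 4 ^ e * (a ^ (e - 2 * γ) + b ^ (e - 2 * γ)) := by
  -- By symmetry let `b ≤ a`; either alternative in `h` then gives `m ≤ 4 * a`. The power `m ^ e` is
  -- absorbed by `a`, and the nonpositive exponent `e - γ` allows `a` to be replaced by `b`.
  have key : ∀ {a b : ℝ}, 0 < a → 0 < b → b ≤ a → m ≤ 4 * a →
      m ^ e * (a ^ (-γ) * b ^ (-γ)) ≤ 4 ^ e * (a ^ (e - 2 * γ) + b ^ (e - 2 * γ)) := by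
    intro a b ha hb hab hma
    calc m ^ e * (a ^ (-γ) * b ^ (-γ)) ≤ (4 * a) ^ e * (a ^ (-γ) * b ^ (-γ)) := by
          gcongr
      _ = 4 ^ e * (a ^ (e - γ) * b ^ (-γ)) := by
          rw [Real.mul_rpow (by norm_num) ha.le, sub_eq_add_neg, Real.rpow_add ha]; ring
      _ ≤ 4 ^ e * (b ^ (e - γ) * b ^ (-γ)) := by
          have := Real.rpow_le_rpow_of_nonpos hb hab (sub_nonpos.2 heγ)
          gcongr
      _ = 4 ^ e * b ^ (e - 2 * γ) := by
          rw [← Real.rpow_add hb]; congr 2; ring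
      _ ≤ _ := by
          have := Real.rpow_nonneg ha.le (e - 2 * γ)
          gcongr
          linarith
  rcases le_total b a with hab | hab
  · exact key ha hb hab (h.elim id fun h => h.trans (by linarith))
  · rw [mul_comm (a ^ (-γ)), add_comm (a ^ _)]
    exact key hb ha hab (h.elim (fun h => h.trans (by linarith)) id)

theorem eigenvalue_le_four_mul (c₀ : {c : ℝ // 0 < c}) {n k : ℕ} (h : n + 1 ≤ 2 * (k + 1)) :
    eigenvalue c₀ n ≤ 4 * eigenvalue c₀ k := by
  have hc := c₀.2
  have h' : (n + 1 : ℝ) ≤ 2 * (k + 1) := by exact_mod_cast h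
  calc eigenvalue c₀ n ≤ c₀ * π ^ 2 * (2 * (k + 1)) ^ 2 := by unfold eigenvalue; gcongr
    _ = _ := by unfold eigenvalue; ring

/-- The summand is a constant times `(n + 1)^(4 s)`, whence the threshold `-1/4`. -/
theorem summable_eigenvalue_rpow (c₀ : {c : ℝ // 0 < c}) {s : ℝ} (hs : s < -(1 / 4)) :
    Summable fun n => (eigenvalue c₀ n ^ s) ^ 2 := by
  have hc := c₀.2
  have h := ((summable_nat_add_iff 1).2
    (Real.summable_nat_rpow.2 (show 4 * s < -1 by linarith))).mul_left (((c₀ * π ^ 2 : ℝ) ^ s) ^ 2)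
  refine h.congr fun n => ?_
  have hn : (0 : ℝ) ≤ (n + 1 : ℝ) := by positivity
  have e : (((n + 1 : ℝ) ^ 2) ^ s) ^ 2 = (n + 1 : ℝ) ^ (4 * s) := by
    rw [← Real.rpow_natCast (((n + 1 : ℝ) ^ 2) ^ s), ← Real.rpow_natCast (n + 1 : ℝ) 2,
      ← Real.rpow_mul hn, ← Real.rpow_mul hn]
    congr 1
    push_cast; ring
  rw [eigenvalue, Real.mul_rpow (x := c₀ * π ^ 2) (by positivity) (by positivity),
    mul_pow (_ ^ s), e]
  push_cast
  rfl

theorem eigenvalue_sqrt (c₀ : {c : ℝ // 0 < c}) (n : ℕ) :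
    (n + 1) * π = (√(c₀ : ℝ))⁻¹ * eigenvalue c₀ n ^ (1 / 2 : ℝ) := by
  have hc := c₀.2
  have hs : √(c₀ : ℝ) ≠ 0 := (Real.sqrt_pos.2 hc).ne'
  have hp : (0 : ℝ) ≤ π * (n + 1) := by positivity
  rw [← Real.sqrt_eq_rpow, eigenvalue, mul_assoc, ← mul_pow, Real.sqrt_mul hc.le,
    Real.sqrt_sq hp]
  field_simp

/-! ### The bilinear estimate -/

/-- The coefficient of `(-A)^r v`. -/
theorem coeff_pow {c₀ : {c : ℝ // 0 < c}} {r : ℝ} (v : HPos c₀ r) (n : ℕ) :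
    coeff (HPos.pow c₀ r v) n = eigenvalue c₀ n ^ r * coeff v.val n :=
  inner_fracPow c₀ r v n

theorem abs_coeff_eq {c₀ : {c : ℝ // 0 < c}} {r : ℝ} (v : HPos c₀ r) (n : ℕ) :
    |coeff v.val n| = eigenvalue c₀ n ^ (-r) * |coeff (HPos.pow c₀ r v) n| := by
  have h := eigenvalue_pos c₀ n
  rw [coeff_pow, abs_mul, abs_of_pos (Real.rpow_pos_of_pos h r), ← mul_assoc, ← Real.rpow_add h]
  simp

theorem sum_coeff_sq_le (v : H) (s : Finset ℕ) : ∑ n ∈ s, |coeff v n| ^ 2 ≤ ‖v‖ ^ 2 := by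
  simpa only [Real.norm_eq_abs] using sineBasis.orthonormal.sum_inner_products_le v (s := s)

theorem inner_mulH_partialSum (f : C(ℝ, ℝ)) (u v : H) (N : ℕ) :
    ⟪toH (partialSum u N), mulH f (toH (partialSum v N))⟫_ℝ =
      ∑ k ∈ Finset.range N, ∑ l ∈ Finset.range N,
        coeff u k * coeff v l * ⟪(sineBasis k : H), mulH f (sineBasis l)⟫_ℝ := by
  simp only [toH_partialSum, map_sum, map_smul, sum_inner, inner_sum, real_inner_smul_left,
    real_inner_smul_right]
  rw [Finset.sum_comm]
  exact Finset.sum_congr rfl fun k _ => Finset.sum_congr rfl fun l _ => by ring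

section

variable {c₀ : {c : ℝ // 0 < c}} {γ ν : ℝ}

/-- The two sums correspond to the two terms of `weight_le`: the decaying weight falls on the
coefficients of `u` in the first and of `v` in the second. Interchanging the indices in the second
gives both the form required by `sum_sq_sum_kernel_le`. -/
theorem abs_weighted_inner_le (hν : ν ≤ 1 / 2) (hνγ : 1 / 2 - γ ≤ ν) (u v : HPos c₀ γ)
    (n N : ℕ) :
    |eigenvalue c₀ n ^ (-ν) * ((n + 1) * π) * ⟪toH (partialSum u.val N),
        mulH (cosineMap n) (toH (partialSum v.val N))⟫_ℝ| ≤
      (√(c₀ : ℝ))⁻¹ * 4 ^ (1 / 2 - ν) * (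
        ∑ k ∈ Finset.range N, ∑ l ∈ Finset.range N, resonance n k l *
          ((eigenvalue c₀ k ^ (1 / 2 - ν - 2 * γ) * |coeff (HPos.pow c₀ γ u) k|) *
            |coeff (HPos.pow c₀ γ v) l|) +
        ∑ k ∈ Finset.range N, ∑ l ∈ Finset.range N, resonance n k l *
          ((eigenvalue c₀ k ^ (1 / 2 - ν - 2 * γ) * |coeff (HPos.pow c₀ γ v) k|) *
            |coeff (HPos.pow c₀ γ u) l|)) := by
  have hn := eigenvalue_pos c₀ n
  have hw : eigenvalue c₀ n ^ (-ν) * ((n + 1) * π) =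
      (√(c₀ : ℝ))⁻¹ * eigenvalue c₀ n ^ (1 / 2 - ν) := by
    rw [eigenvalue_sqrt c₀, mul_left_comm, ← Real.rpow_add hn]
    congr 2; ring
  rw [hw, inner_mulH_partialSum, Finset.sum_comm (f := fun k l => resonance n k l *
    ((eigenvalue c₀ k ^ (1 / 2 - ν - 2 * γ) * |coeff (HPos.pow c₀ γ v) k|) *
            |coeff (HPos.pow c₀ γ u) l|)), mul_assoc, mul_assoc, abs_mul,
    abs_of_nonneg (inv_nonneg.2 (Real.sqrt_nonneg _)), abs_mul,
    abs_of_pos (Real.rpow_pos_of_pos hn _)]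
  refine mul_le_mul_of_nonneg_left ?_ (inv_nonneg.2 (Real.sqrt_nonneg _))
  refine (mul_le_mul_of_nonneg_left (Finset.abs_sum_le_sum_abs _ _)
    (Real.rpow_nonneg hn.le _)).trans ?_
  rw [← Finset.sum_add_distrib, Finset.mul_sum, Finset.mul_sum]
  refine Finset.sum_le_sum fun k _ => ?_
  refine (mul_le_mul_of_nonneg_left (Finset.abs_sum_le_sum_abs _ _)
    (Real.rpow_nonneg hn.le _)).trans ?_
  rw [← Finset.sum_add_distrib, Finset.mul_sum, Finset.mul_sum]
  refine Finset.sum_le_sum fun l _ => ?_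
  rw [abs_mul, abs_mul, abs_coeff_eq, abs_coeff_eq, resonance_comm n l k]
  have hr := abs_inner_mulH_cosineMap_le n k l
  set α := |coeff (HPos.pow c₀ γ u) k| with hα
  set β := |coeff (HPos.pow c₀ γ v) l| with hβ
  have hα0 : 0 ≤ α := abs_nonneg _
  have hβ0 : 0 ≤ β := abs_nonneg _
  have hk := eigenvalue_pos c₀ k
  have hl := eigenvalue_pos c₀ l
  by_cases hz : resonance n k l = 0
  · have : |⟪(sineBasis k : H), mulH (cosineMap n) (sineBasis l)⟫_ℝ| = 0 :=
      le_antisymm (hr.trans_eq hz) (abs_nonneg _)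
    rw [this, hz]
    simp
  have hor : eigenvalue c₀ n ≤ 4 * eigenvalue c₀ k ∨ eigenvalue c₀ n ≤ 4 * eigenvalue c₀ l := by
    by_contra! hcon
    refine hz (resonance_eq_zero_of_lt ?_ ?_)
    · by_contra! h
      exact absurd (eigenvalue_le_four_mul c₀ h) hcon.1.not_ge
    · by_contra! h
      exact absurd (eigenvalue_le_four_mul c₀ h) hcon.2.not_ge
  have key := weight_le hk hl hn (sub_nonneg.2 hν) (show 1 / 2 - ν ≤ γ by linarith) hor
  calc _ ≤ eigenvalue c₀ n ^ (1 / 2 - ν) * (eigenvalue c₀ k ^ (-γ) * α *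
        (eigenvalue c₀ l ^ (-γ) * β) * resonance n k l) := by
        gcongr
    _ = eigenvalue c₀ n ^ (1 / 2 - ν) * (eigenvalue c₀ k ^ (-γ) * eigenvalue c₀ l ^ (-γ)) *
        (α * β * resonance n k l) := by ring
    _ ≤ 4 ^ (1 / 2 - ν) * (eigenvalue c₀ k ^ (1 / 2 - ν - 2 * γ) +
        eigenvalue c₀ l ^ (1 / 2 - ν - 2 * γ)) * (α * β * resonance n k l) :=
        mul_le_mul_of_nonneg_right key
          (mul_nonneg (mul_nonneg hα0 hβ0) (resonance_nonneg n k l))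
    _ = _ := by ring

theorem sum_sq_resonance_le {s : ℝ} (hs : s < -(1 / 4)) (u v : H) (M N : ℕ) :
    ∑ n ∈ Finset.range M, (∑ k ∈ Finset.range N, ∑ l ∈ Finset.range N, resonance n k l *
      ((eigenvalue c₀ k ^ s * |coeff u k|) * |coeff v l|)) ^ 2 ≤
    9 * (∑' k, (eigenvalue c₀ k ^ s) ^ 2) * (‖u‖ * ‖v‖) ^ 2 := by
  have h := sum_sq_sum_kernel_le resonance_nonneg sum_resonance_left_le sum_resonance_right_le
    (Finset.range M) (Finset.range N) (x := fun k => eigenvalue c₀ k ^ s * |coeff u k|)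
    (y := fun l => |coeff v l|)
    (fun k => mul_nonneg (Real.rpow_nonneg (eigenvalue_pos c₀ k).le _) (abs_nonneg _))
  refine h.trans ?_
  have h1 : (∑ k ∈ Finset.range N, eigenvalue c₀ k ^ s * |coeff u k|) ^ 2 ≤
      (∑' k, (eigenvalue c₀ k ^ s) ^ 2) * ‖u‖ ^ 2 := by
    refine (Finset.sum_mul_sq_le_sq_mul_sq _ _ _).trans ?_
    refine mul_le_mul ?_ (sum_coeff_sq_le u _) (Finset.sum_nonneg fun _ _ => sq_nonneg _)
      (tsum_nonneg fun _ => sq_nonneg _)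
    exact (summable_eigenvalue_rpow c₀ hs).sum_le_tsum _ fun _ _ => sq_nonneg _
  have h2 := sum_coeff_sq_le v (Finset.range N)
  calc _ ≤ 3 ^ 2 * (((∑' k, (eigenvalue c₀ k ^ s) ^ 2) * ‖u‖ ^ 2) * ‖v‖ ^ 2) := by
        gcongr
    _ = _ := by ring

/-- The bilinear estimate `‖∂(u v)‖_{H_{-ν}} ≤ C ‖u‖_{H_γ} ‖v‖_{H_γ}` in terms of coefficients. -/
theorem exists_sum_sq_weighted_inner_le (c₀ : {c : ℝ // 0 < c}) (hν : ν ≤ 1 / 2)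
    (hνγ : 1 / 2 - γ ≤ ν) (hs : 3 / 4 - 2 * γ < ν) :
    ∃ C, 0 ≤ C ∧ ∀ (u v : HPos c₀ γ) (M : ℕ),
      ∑ n ∈ Finset.range M, (eigenvalue c₀ n ^ (-ν) * ((n + 1) * π) *
        ⟪u.val, mulH (cosineMap n) v.val⟫_ℝ) ^ 2 ≤ (C * (‖u‖ * ‖v‖)) ^ 2 := by
  set K : ℝ := (√(c₀ : ℝ))⁻¹ * 4 ^ (1 / 2 - ν) with hK
  set S : ℝ := ∑' k, (eigenvalue c₀ k ^ (1 / 2 - ν - 2 * γ)) ^ 2 with hS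
  have hS0 : 0 ≤ S := tsum_nonneg fun _ => sq_nonneg _
  have hK0 : 0 ≤ K := by positivity
  refine ⟨6 * K * √S, by positivity, fun u v M => ?_⟩
  -- With `M` fixed the sum over `n` is finite, so it suffices to bound the partial sums of `u` and
  -- `v` uniformly in `N`.
  have lim : Tendsto (fun N => ∑ n ∈ Finset.range M, (eigenvalue c₀ n ^ (-ν) * ((n + 1) * π) *
      ⟪toH (partialSum u.val N), mulH (cosineMap n) (toH (partialSum v.val N))⟫_ℝ) ^ 2) atTop
      (𝓝 (∑ n ∈ Finset.range M, (eigenvalue c₀ n ^ (-ν) * ((n + 1) * π) *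
        ⟪u.val, mulH (cosineMap n) v.val⟫_ℝ) ^ 2)) :=
    tendsto_finsetSum _ fun n _ => (((tendsto_partialSum u.val).inner (𝕜 := ℝ)
      (((mulH (cosineMap n)).continuous.tendsto _).comp
        (tendsto_partialSum v.val))).const_mul _).pow 2
  refine le_of_tendsto lim (Eventually.of_forall fun N => ?_)
  have h1 := sum_sq_resonance_le (c₀ := c₀) (s := 1 / 2 - ν - 2 * γ) (by linarith)
    (HPos.pow c₀ γ u) (HPos.pow c₀ γ v) M N
  have h2 := sum_sq_resonance_le (c₀ := c₀) (s := 1 / 2 - ν - 2 * γ) (by linarith)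
    (HPos.pow c₀ γ v) (HPos.pow c₀ γ u) M N
  rw [← hS, ← HPos.norm_def, ← HPos.norm_def] at h1 h2
  rw [mul_comm ‖v‖] at h2
  have hle := fun n => abs_weighted_inner_le hν hνγ u v n N
  -- From `(P + Q)² ≤ 2 (P² + Q²)` the total is at most `2 K² (9 S + 9 S) = (6 K √S)²` times `(‖u‖
  -- ‖v‖)²`.
  have combine : ∀ T P Q : ℕ → ℝ, (∀ n, |T n| ≤ K * (P n + Q n)) →
      ∑ n ∈ Finset.range M, P n ^ 2 ≤ 9 * S * (‖u‖ * ‖v‖) ^ 2 →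
      ∑ n ∈ Finset.range M, Q n ^ 2 ≤ 9 * S * (‖u‖ * ‖v‖) ^ 2 →
      ∑ n ∈ Finset.range M, T n ^ 2 ≤ (6 * K * √S * (‖u‖ * ‖v‖)) ^ 2 := by
    intro T P Q hT hP hQ
    calc ∑ n ∈ Finset.range M, T n ^ 2
        ≤ ∑ n ∈ Finset.range M, 2 * K ^ 2 * (P n ^ 2 + Q n ^ 2) := by
          refine Finset.sum_le_sum fun n _ => ?_
          rw [← sq_abs]
          refine (pow_le_pow_left₀ (abs_nonneg _) (hT n) 2).trans ?_
          nlinarith [mul_nonneg (sq_nonneg K) (sq_nonneg (P n - Q n))]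
      _ = 2 * K ^ 2 * (∑ n ∈ Finset.range M, P n ^ 2 + ∑ n ∈ Finset.range M, Q n ^ 2) := by
          rw [← Finset.mul_sum, Finset.sum_add_distrib]
      _ ≤ 2 * K ^ 2 * (9 * S * (‖u‖ * ‖v‖) ^ 2 + 9 * S * (‖u‖ * ‖v‖) ^ 2) := by gcongr
      _ = _ := by
          linear_combination (-36 * K ^ 2 * (‖u‖ * ‖v‖) ^ 2) * Real.sq_sqrt hS0
  exact combine _ _ _ hle h1 h2

end

/-! ### The Lipschitz estimate on `H_{1/2}` -/

theorem norm_le_of_sum_sq_le {x : H} {C : ℝ} (hC : 0 ≤ C)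
    (h : ∀ M, ∑ n ∈ Finset.range M, coeff x n ^ 2 ≤ C ^ 2) : ‖x‖ ≤ C := by
  have hs := (sineBasis.hasSum_inner_mul_inner x x).tendsto_sum_nat
  rw [real_inner_self_eq_norm_sq] at hs
  refine abs_le_of_sq_le_sq' (le_of_tendsto hs (Eventually.of_forall fun M => ?_)) hC |>.2
  refine le_trans (le_of_eq ?_) (h M)
  refine Finset.sum_congr rfl fun n _ => ?_
  rw [real_inner_comm, sq]

theorem norm_toHNeg_sub_le (c₀ : {c : ℝ // 0 < c}) (ν : ℝ≥0) (a b : H) {C : ℝ} (hC : 0 ≤ C)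
    (h : ∀ M, ∑ n ∈ Finset.range M, (eigenvalue c₀ n ^ (-(ν : ℝ)) * coeff (a - b) n) ^ 2 ≤ C ^ 2) :
    ‖toHNeg c₀ ν a - toHNeg c₀ ν b‖ ≤ C := by
  rw [toHNeg, toHNeg, ← UniformSpace.Completion.coe_sub, UniformSpace.Completion.norm_coe,
    HPos.norm_def]
  refine norm_le_of_sum_sq_le hC fun M => ?_
  simp_rw [coeff_pow]
  exact h M

theorem exists_norm_burgersF_sub_le (c₀ : {c : ℝ // 0 < c}) (c₁ : ℝ) {γ : ℝ} (hγ : γ ≤ 1 / 2)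
    {ν : ℝ≥0} (hν : (ν : ℝ) ≤ 1 / 2) (hνγ : 1 / 2 - γ ≤ ν) (hs : 3 / 4 - 2 * γ < ν) :
    ∃ C, ∀ v w : HPos c₀ (1 / 2),
      ‖toHNeg c₀ ν (burgersF c₀ c₁ v) - toHNeg c₀ ν (burgersF c₀ c₁ w)‖ ≤
        C * ‖HPos.incl c₀ hγ v - HPos.incl c₀ hγ w‖ *
          (1 + ‖HPos.incl c₀ hγ v‖ + ‖HPos.incl c₀ hγ w‖) := by
  obtain ⟨C, hC, h⟩ := exists_sum_sq_weighted_inner_le c₀ hν hνγ hs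
  refine ⟨|c₁| / 2 * C, fun v w => ?_⟩
  set v' := HPos.incl c₀ hγ v with hv'
  set w' := HPos.incl c₀ hγ w with hw'
  -- The quadratic form yields the factor `‖v' + w'‖`; the summand `1` is only slack.
  have hle : ‖v' + w'‖ ≤ 1 + ‖v'‖ + ‖w'‖ := by linarith [norm_add_le v' w']
  refine (norm_toHNeg_sub_le c₀ ν _ _ (C := |c₁| / 2 * C * ‖v' - w'‖ * ‖v' + w'‖)
    (by positivity) fun M => ?_).trans (by gcongr)
  have e : ∀ n, (eigenvalue c₀ n ^ (-(ν : ℝ)) *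
      coeff (burgersF c₀ c₁ v - burgersF c₀ c₁ w) n) ^ 2 =
      (|c₁| / 2) ^ 2 * (eigenvalue c₀ n ^ (-(ν : ℝ)) * ((n + 1) * π) *
        ⟪(v' - w').val, mulH (cosineMap n) (v' + w').val⟫_ℝ) ^ 2 := by
    intro n
    rw [coeff_burgersF_sub, div_pow, sq_abs]
    change (_ * (_ * ⟪(v' - w').val, mulH (cosineMap n) (v' + w').val⟫_ℝ)) ^ 2 = _
    ring
  simp_rw [e]
  rw [← Finset.mul_sum]
  refine (mul_le_mul_of_nonneg_left (h (v' - w') (v' + w') M) (sq_nonneg _)).trans_eq ?_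
  ring

/-! ### Density of `H_s` in `H_r` -/

theorem sineBasis_mem_fracDomain (c₀ : {c : ℝ // 0 < c}) (r : ℝ) (k : ℕ) :
    (sineBasis k : H) ∈ fracDomain c₀ r := by
  rw [mem_fracDomain_iff]
  refine summable_of_ne_finset_zero (s := {k}) fun n hn => ?_
  rw [sineBasis.orthonormal.inner_eq_zero (by simpa using hn)]
  simp

/-- The basis vector `e_k` as an element of `H_r`. -/
def HPos.basisVec (c₀ : {c : ℝ // 0 < c}) (r : ℝ) (k : ℕ) : HPos c₀ r :=
  (⟨sineBasis k, sineBasis_mem_fracDomain c₀ r k⟩ : fracDomain c₀ r)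

theorem HPos.incl_basisVec (c₀ : {c : ℝ // 0 < c}) {r s : ℝ} (h : r ≤ s) (k : ℕ) :
    HPos.incl c₀ h (HPos.basisVec c₀ s k) = HPos.basisVec c₀ r k := rfl

theorem HPos.pow_basisVec (c₀ : {c : ℝ // 0 < c}) (r : ℝ) (k : ℕ) :
    HPos.pow c₀ r (HPos.basisVec c₀ r k) = eigenvalue c₀ k ^ r • (sineBasis k : H) := by
  classical
  apply sineBasis.repr.injective
  ext n
  rw [HilbertBasis.repr_apply_apply, HilbertBasis.repr_apply_apply, real_inner_smul_right]
  refine (coeff_pow _ n).trans ?_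
  change _ * ⟪sineBasis n, (sineBasis k : H)⟫_ℝ = _
  rw [orthonormal_iff_ite.1 sineBasis.orthonormal n k]
  split_ifs with h <;> simp [h]

/-- Finite combinations of the `e_k` lie in every `H_s`. Since `(-A)^r` is an isometry into `H`, the
sine expansion of `(-A)^r v`, pulled back by `λ_k^(-r)`, converges to `v` in `H_r`. -/
theorem HPos.denseRange_incl (c₀ : {c : ℝ // 0 < c}) {r s : ℝ} (h : r ≤ s) :
    DenseRange (HPos.incl c₀ h) := by
  intro v
  refine mem_closure_of_tendsto (f := fun N : ℕ => HPos.incl c₀ h (∑ k ∈ Finset.range N,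
    (coeff (HPos.pow c₀ r v) k * eigenvalue c₀ k ^ (-r)) • HPos.basisVec c₀ s k)) (b := atTop) ?_
    (Eventually.of_forall fun N => mem_range_self _)
  rw [tendsto_iff_norm_sub_tendsto_zero]
  have hlim := tendsto_iff_norm_sub_tendsto_zero.1 (tendsto_partialSum (HPos.pow c₀ r v))
  refine hlim.congr fun N => ?_
  rw [HPos.norm_def, map_sub, toH_partialSum, map_sum, map_sum]
  congr 2
  refine Finset.sum_congr rfl fun k _ => ?_
  rw [map_smul, map_smul, HPos.incl_basisVec, HPos.pow_basisVec, smul_smul, mul_assoc,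
    ← Real.rpow_add (eigenvalue_pos c₀ k)]
  simp

/-! ### Extension of locally Lipschitz functions from a dense subset -/

/-- As both points tend to `a`, the right side of `hf` tends to `0`, so the image filter is Cauchy;
the growth factor stays bounded near `a`. -/
theorem exists_tendsto_of_norm_sub_le {E Y : Type*} [NormedAddCommGroup E] [NormedAddCommGroup Y]
    [CompleteSpace Y] {s : Set E} (hs : Dense s) {f : s → Y} {C : ℝ}
    (hf : ∀ x y : s, ‖f x - f y‖ ≤ C * ‖(x : E) - y‖ * (1 + ‖(x : E)‖ + ‖(y : E)‖)) (a : E) :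
    ∃ b, Tendsto f (comap Subtype.val (𝓝 a)) (𝓝 b) := by
  have hne : (comap (Subtype.val : s → E) (𝓝 a)).NeBot := hs.isDenseInducing_val.comap_nhds_neBot a
  refine cauchy_map_iff_exists_tendsto.1 (cauchy_map_iff.2 ⟨hne, ?_⟩)
  rw [tendsto_uniformity_iff_dist_tendsto_zero]
  have h1 : Tendsto (fun p : s × s => (p.1 : E))
      (comap Subtype.val (𝓝 a) ×ˢ comap Subtype.val (𝓝 a)) (𝓝 a) :=
    tendsto_comap.comp tendsto_fst
  have h2 : Tendsto (fun p : s × s => (p.2 : E))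
      (comap Subtype.val (𝓝 a) ×ˢ comap Subtype.val (𝓝 a)) (𝓝 a) :=
    tendsto_comap.comp tendsto_snd
  have h3 := ((h1.sub h2).norm.const_mul C).mul ((h1.norm.const_add 1).add h2.norm)
  rw [sub_self, norm_zero, mul_zero, zero_mul] at h3
  exact squeeze_zero (fun _ => dist_nonneg)
    (fun p => (dist_eq_norm (f p.1) (f p.2)).trans_le (hf p.1 p.2)) h3

theorem exists_continuous_extension {X E Y : Type*} [NormedAddCommGroup E] [NormedAddCommGroup Y]
    [CompleteSpace Y] {i : X → E} (hi : DenseRange i) {f : X → Y} {C : ℝ}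
    (hf : ∀ x y, ‖f x - f y‖ ≤ C * ‖i x - i y‖ * (1 + ‖i x‖ + ‖i y‖)) :
    ∃ g : E → Y, Continuous g ∧ ∀ x, g (i x) = f x := by
  have hd : Dense (range i) := hi
  -- `i` need not be injective: by `hf`, points with the same image under `i` have the same value
  -- under `f`, so the choice of preimage is immaterial.
  let f' : range i → Y := fun y => f y.2.choose
  have hf' : ∀ x y : range i,
      ‖f' x - f' y‖ ≤ C * ‖(x : E) - y‖ * (1 + ‖(x : E)‖ + ‖(y : E)‖) := fun x y => by
    simpa only [x.2.choose_spec, y.2.choose_spec] using hf x.2.choose y.2.choose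
  have hlim := exists_tendsto_of_norm_sub_le hd hf'
  refine ⟨hd.extend f', hd.continuous_extend hlim, fun x => ?_⟩
  have hx := hd.isDenseInducing_val.extend_eq' hlim ⟨i x, mem_range_self x⟩
  refine hx.trans (sub_eq_zero.1 (norm_le_zero_iff.1 ((hf _ x).trans_eq ?_)))
  rw [(mem_range_self x : i x ∈ range i).choose_spec, sub_self, norm_zero, mul_zero, zero_mul]

end Burgers

end

theorem mainTheorem4 (c₀ : {c : ℝ // 0 < c}) (c₁ : ℝ) (γ : ℝ) (ν : ℝ≥0)
    (hγ : γ ∈ Set.Ioc (1 / 8 : ℝ) (1 / 2))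
    (hν : (ν : ℝ) ∈ Set.Icc (1 / 2 - γ) (1 / 2)) (hνγ : 3 / 4 - 2 * γ < (ν : ℝ)) :
    (∀ w : HPos c₀ (1 / 2), IsWeakDeriv w.val (weakDeriv w.val) ∧
      burgersF c₀ c₁ w =ᵐ[lam] fun x => c₁ * (w.val x * weakDeriv w.val x)) ∧
    (∃! G : HPos c₀ γ → HNeg c₀ ν, IsContExtension c₀ c₁ hγ.2 ν G) ∧
    (∀ G : HPos c₀ γ → HNeg c₀ ν, IsContExtension c₀ c₁ hγ.2 ν G →
      ∃ C : ℝ, ∀ v w : HPos c₀ γ, ‖G v - G w‖ ≤ C * ‖v - w‖ * (1 + ‖v‖ + ‖w‖)) := by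
  have hd := HPos.denseRange_incl c₀ hγ.2
  obtain ⟨C, hC⟩ := exists_norm_burgersF_sub_le c₀ c₁ hγ.2 hν.2 hν.1 hνγ
  refine ⟨fun w => ⟨w.isH1.isWeakDeriv, coeFn_burgersF c₀ c₁ w⟩, ?_, fun G hG => ⟨C, ?_⟩⟩
  · obtain ⟨G, hG, hGF⟩ := exists_continuous_extension hd hC
    refine ⟨G, ⟨hG, hGF⟩, fun G' hG' => hd.equalizer hG'.1 hG (funext fun v => ?_)⟩
    exact (hG'.2 v).trans (hGF v).symm
  · have hc := hG.1
    -- The inequality is a closed condition on pairs, so it need only be checked on the dense image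
    -- of `H_{1/2}`, where `G` is given by `F`.
    refine fun v w => hd.induction_on₂ (p := fun v w =>
      ‖G v - G w‖ ≤ C * ‖v - w‖ * (1 + ‖v‖ + ‖w‖)) ?_ (fun v w => ?_) v w
    · exact isClosed_le (by fun_prop) (by fun_prop)
    · rw [hG.2, hG.2]
      exact hC v w
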